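/- Let $m$ be a natural number. Let $\mathcal P$ be the fan of $\mathbb P^2$ in $\mathbb R^2$, i.e. the seven cones generated by the proper subsets of $\{(1,0),(0,1),(-1,-1)\}$, and let $\mathcal P^\vee=-\mathcal P$. *Quotient fans.* For $\mathcal F\in\{\mathcal P,\mathcal P^\vee\}$ and $k\ge 0$ let $\mathcal F^k$ be the product fan in $\mathbb R^{2k}=(\mathbb R^2)^k$, and let $\mathbb R^2$ act on $\mathbb R^{2k}$ by diagonal translations. For $v\in\mathbb R^{2k}$ put $\mathcal F^k_v=\{\sigma\in\mathcal F^k : \sigma\cap(v+\mathbb R^2)\ne\emptyset\}$, and call $v,w$ equivalent if $\mathcal F^k_v=\mathcal F^k_w$. The quotient fan consists of the images in $\mathbb R^{2k}/\mathbb R^2$ of the closures of the equivalence classes; the image of the closure of the class of $v$ is called the cone of $v$. The quotient fan is denoted $\mathcal Q_k$ for $\mathcal F=\mathcal P$ and $\mathcal Q_k^\vee$ (the dual quotient fan) for $\mathcal F=\mathcal P^\vee$. (Two vectors $v,w$ are equivalent with respect to $\mathcal P$ exactly when the subdivisions $\mathcal S(v)$, $\mathcal S(w)$ of $\mathbb R^2$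 are combinatorially equivalent, where $\mathcal S(v)$ is cut out by the spiders with centres $-v_i\in\mathbb R^2$ and rays in the directions $(1,0),(0,1),(-1,-1)$.) *Additional points.* The dual spider $S(p)^\vee$ of $p\in\mathbb R^2$ is the union of the three rays from $-p$ in the directions $(-1,0),(0,-1),(1,1)$. For $p,q\in\mathbb R^2$ let $(c,d)=p-q$ be the position of $-q$ relative to $-p$. If $c\neq0$, $d\neq0$ and $c\neq d$, then $S(p)^\vee\cap S(q)^\vee$ is a single point; write it as $-r$. Define $(x_{12},x_{13},x_{23})\in(\mathbb R^2)^3$ by $$\begin{array}{ll|ll} c=d>0: & (q,p,q) & c=d<0: & (p,q,p)\\ c=0>d: & (p,q,q) & c=0<d: & (q,p,p)\\ d=0>c: & (q,q,p) & d=0<c: & (p,p,q)\\ c>0>d: & (p,r,q) & c<0<d: & (q,r,p)\\ 0<c<d: & (q,p,r) & d<c<0: & (p,q,r)\\ 0<d<c: & (r,p,q) & c<d<0: & (r,q,p) \end{array}$$ and $(p,p,p)$ if $p=q$. *The new fan.* Let $N=\binom32\binom m2$ and let $\iota\colon\mathbb R^{2m}\to\mathbb R^{2m+2N}$ be the map $v\mapsto(v,x)$,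 where for $i<j$ the components $x_{12,ij},x_{13,ij},x_{23,ij}\in\mathbb R^2$ of $x$ are the three points attached as above to $p=v_i$, $q=v_j$. It commutes with diagonal translations, hence induces $\bar\iota\colon\mathbb R^{2m}/\mathbb R^2\to\mathbb R^{2m+2N}/\mathbb R^2$. Let $\mathcal Q'_{m+N}\subseteq\mathcal Q_{m+N}$ be the collection of the cones of the vectors $\iota(v)$, $v\in\mathbb R^{2m}$, and let $\widetilde{\mathcal Q}_m=\{\bar\iota^{-1}(\sigma) : \sigma\in\mathcal Q'_{m+N}\}$. **Theorem.** The fan $\widetilde{\mathcal Q}_m$ refines the dual quotient fan $\mathcal Q_m^\vee$ in $\mathbb R^{2m}/\mathbb R^2$: every cone of $\widetilde{\mathcal Q}_m$ is contained in a cone of $\mathcal Q_m^\vee$, and every cone of $\mathcal Q_m^\vee$ is a union of cones of $\widetilde{\mathcal Q}_m$. -/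

import Mathlib

namespace SpiderFan

/-! ### The fan of the projective plane, its dual, and quotient fans -/

/-- The primitive generators `(1,0)`, `(0,1)`, `(-1,-1)` of the rays of the fan of `ℙ²`. -/
def rayGen : Fin 3 → ℝ × ℝ := ![(1, 0), (0, 1), (-1, -1)]

/-- The fan `𝒫` of `ℙ²` in `ℝ²`: the seven cones generated by the proper subsets of the set of
ray generators. -/
def fanP : Set (Set (ℝ × ℝ)) :=
  {σ | ∃ T : Set (Fin 3), T ≠ Set.univ ∧ σ = (PointedCone.hull ℝ (rayGen '' T) : Set (ℝ × ℝ))}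

/-- The fan `𝒫^∨ = -𝒫` of the dual projective plane. -/
def fanPDual : Set (Set (ℝ × ℝ)) :=
  {σ | ∃ τ ∈ fanP, σ = (fun x => -x) '' τ}

/-- The product fan `F^I` in `(ℝ²)^I`, whose cones are the products of cones of `F`. -/
def productFan (F : Set (Set (ℝ × ℝ))) (I : Type) : Set (Set (I → ℝ × ℝ)) :=
  {σ | ∃ s : I → Set (ℝ × ℝ), (∀ i, s i ∈ F) ∧ σ = Set.pi Set.univ s}

/-- `ℝ²`, diagonally embedded in `(ℝ²)^I`. -/
def diag (I : Type) : Submodule ℝ (I → ℝ × ℝ) :=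
  LinearMap.range (LinearMap.pi fun _ : I => (LinearMap.id : ℝ × ℝ →ₗ[ℝ] ℝ × ℝ))

/-- The cones of the product fan `F^I` that meet the translate `v + ℝ²` of the diagonal. -/
def metCones (F : Set (Set (ℝ × ℝ))) {I : Type} (v : I → ℝ × ℝ) : Set (Set (I → ℝ × ℝ)) :=
  {σ ∈ productFan F I | (σ ∩ {x | x - v ∈ diag I}).Nonempty}

/-- The equivalence class of `v`: the vectors `w` for which `w + ℝ²` meets the same cones of
`F^I` as `v + ℝ²`. -/
def equivClass (F : Set (Set (ℝ × ℝ))) {I : Type} (v : I → ℝ × ℝ) : Set (I → ℝ × ℝ) :=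
  {w | metCones F w = metCones F v}

/-- The cone in `(ℝ²)^I / ℝ²` attached to `v`: the image, under the quotient map, of the closure
of the equivalence class of `v`. -/
def quotientCone (F : Set (Set (ℝ × ℝ))) {I : Type} (v : I → ℝ × ℝ) :
    Set ((I → ℝ × ℝ) ⧸ diag I) :=
  (diag I).mkQ '' closure (equivClass F v)

/-- The quotient fan in `(ℝ²)^I / ℝ²` of the product fan `F^I`: the collection of the images of
the closures of the equivalence classes. -/
def quotientFan (F : Set (Set (ℝ × ℝ))) (I : Type) : Set (Set ((I → ℝ × ℝ) ⧸ diag I)) :=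
  Set.range fun v : I → ℝ × ℝ => quotientCone F v

/-- The dual quotient fan `𝒬_m^∨`. -/
def fanQDual (m : ℕ) : Set (Set ((Fin m → ℝ × ℝ) ⧸ diag (Fin m))) :=
  quotientFan fanPDual (Fin m)

/-! ### The additional points attached to a pair of spiders -/

/-- The dual spider with centre `-v`: its rays point left, down, and up right. -/
def dualSpider (v : ℝ × ℝ) : Set (ℝ × ℝ) :=
  {z | ∃ t : ℝ, 0 ≤ t ∧ z = (-v.1 - t, -v.2)} ∪ {z | ∃ t : ℝ, 0 ≤ t ∧ z = (-v.1, -v.2 - t)} ∪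
    {z | ∃ t : ℝ, 0 ≤ t ∧ z = (-v.1 + t, -v.2 + t)}

/-- Let `(c, d)` be the position of the centre `-w` relative to the centre `-v`. If `c ≠ 0`,
`d ≠ 0` and `c ≠ d`, then the dual spiders of `v` and `w` meet in exactly one point, and
`redPoint v w` is the negative of that point (see `dualSpider_inter_dualSpider`). In the remaining
cases, in which it is not used, the value is irrelevant. -/
noncomputable def redPoint (v w : ℝ × ℝ) : ℝ × ℝ :=
  let c := v.1 - w.1
  let d := v.2 - w.2
  if 0 < c ∧ d < 0 then (v.1, w.2)
  else if 0 < c ∧ c < d then (w.1, v.2 + w.1 - v.1)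
  else if 0 < d ∧ d < c then (v.1 + w.2 - v.2, w.2)
  else if c < 0 ∧ 0 < d then (w.1, v.2)
  else if d < c ∧ c < 0 then (v.1, w.2 + v.1 - w.1)
  else if c < d ∧ d < 0 then (w.1 + v.2 - w.2, v.2)
  else v

theorem mem_dualSpider (v z : ℝ × ℝ) : z ∈ dualSpider v ↔
    (z.2 = -v.2 ∧ z.1 ≤ -v.1) ∨ (z.1 = -v.1 ∧ z.2 ≤ -v.2) ∨
      (z.1 + v.1 = z.2 + v.2 ∧ 0 ≤ z.1 + v.1) := by
  obtain ⟨a, b⟩ := v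
  obtain ⟨x, y⟩ := z
  simp only [dualSpider, Set.mem_union, Set.mem_ofPred_eq, Prod.mk.injEq]
  constructor
  · rintro ((⟨t, ht, h, k⟩ | ⟨t, ht, h, k⟩) | ⟨t, ht, h, k⟩)
    · exact Or.inl ⟨k, by linarith⟩
    · exact Or.inr (Or.inl ⟨h, by linarith⟩)
    · exact Or.inr (Or.inr ⟨by linarith, by linarith⟩)
  · rintro (⟨h, k⟩ | ⟨h, k⟩ | ⟨h, k⟩)
    · exact Or.inl (Or.inl ⟨-a - x, by linarith, by ring, h⟩)
    · exact Or.inl (Or.inr ⟨-b - y, by linarith, h, by ring⟩)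
    · exact Or.inr ⟨x + a, k, by ring, by linarith⟩

theorem dualSpider_inter_dualSpider (v w : ℝ × ℝ) (h₁ : v.1 ≠ w.1) (h₂ : v.2 ≠ w.2)
    (h₃ : v.1 - w.1 ≠ v.2 - w.2) : dualSpider v ∩ dualSpider w = {-redPoint v w} := by
  obtain ⟨a, b⟩ := v
  obtain ⟨c, d⟩ := w
  ext ⟨x, y⟩
  simp only [Set.mem_inter_iff, mem_dualSpider, Set.mem_singleton_iff, redPoint] at *
  rcases lt_or_gt_of_ne h₁ with h₁ | h₁ <;> rcases lt_or_gt_of_ne h₂ with h₂ | h₂ <;>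
    rcases lt_or_gt_of_ne h₃ with h₃ | h₃ <;> split_ifs <;>
    simp only [Prod.neg_mk, Prod.mk.injEq] <;> grind

/-- The three pairs `αβ = 12, 13, 23` of indices of heavy points. -/
inductive HeavyPair : Type
  | e12
  | e13
  | e23

/-- The triple `(x₁₂, x₁₃, x₂₃)` as a function of the pair `αβ`. -/
def triple (x₁₂ x₁₃ x₂₃ : ℝ × ℝ) : HeavyPair → ℝ × ℝ
  | .e12 => x₁₂
  | .e13 => x₁₃
  | .e23 => x₂₃

/-- The points `x_{αβ}` attached to the pair of spiders with parameters `v` and `w`, according to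
the position `(c, d)` of the centre `-w` relative to the centre `-v`. In the last case `v = w`. -/
noncomputable def extraPoint (v w : ℝ × ℝ) : HeavyPair → ℝ × ℝ :=
  let c := v.1 - w.1
  let d := v.2 - w.2
  if c = d ∧ 0 < d then triple w v w
  else if c = 0 ∧ d < 0 then triple v w w
  else if d = 0 ∧ c < 0 then triple w w v
  else if c = d ∧ d < 0 then triple v w v
  else if c = 0 ∧ 0 < d then triple w v v
  else if d = 0 ∧ 0 < c then triple v v w
  else if 0 < c ∧ d < 0 then triple v (redPoint v w) w
  else if 0 < c ∧ c < d then triple w v (redPoint v w)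
  else if 0 < d ∧ d < c then triple (redPoint v w) v w
  else if c < 0 ∧ 0 < d then triple w (redPoint v w) v
  else if d < c ∧ c < 0 then triple v w (redPoint v w)
  else if c < d ∧ d < 0 then triple (redPoint v w) w v
  else triple v v v

/-- The index set of the `m + N` spiders, where `N = 3 * (m.choose 2)`: the indices `i` of the
given spiders, and the pairs `(αβ, ij)` with `i < j`. -/
abbrev Idx (m : ℕ) : Type := Fin m ⊕ (HeavyPair × {p : Fin m × Fin m // p.1 < p.2})

/-- The map `ι : ℝ^{2m} → ℝ^{2m+2N}`, `v ↦ (v, x)`. -/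
noncomputable def iota (m : ℕ) (v : Fin m → ℝ × ℝ) : Idx m → ℝ × ℝ
  | .inl i => v i
  | .inr (k, p) => extraPoint (v p.1.1) (v p.1.2) k

theorem redPoint_add (v w a : ℝ × ℝ) : redPoint (v + a) (w + a) = redPoint v w + a := by
  simp only [redPoint, Prod.fst_add, Prod.snd_add, add_sub_add_right_eq_sub]
  split_ifs <;> ext <;> simp <;> ring

theorem extraPoint_add (v w a : ℝ × ℝ) (k : HeavyPair) :
    extraPoint (v + a) (w + a) k = extraPoint v w k + a := by
  simp only [extraPoint, Prod.fst_add, Prod.snd_add, add_sub_add_right_eq_sub, redPoint_add]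
  have H : ∀ (p : Prop) [Decidable p] (f g f' g' : HeavyPair → ℝ × ℝ), f k = f' k + a →
      g k = g' k + a → (if p then f else g) k = (if p then f' else g') k + a := by
    intro p _ f g f' g' h₁ h₂
    split_ifs
    exacts [h₁, h₂]
  have T : ∀ x y z : ℝ × ℝ, triple (x + a) (y + a) (z + a) k = triple x y z k + a := by
    intro x y z
    cases k <;> rfl
  repeat' first | exact T _ _ _ | apply H

theorem iota_sub_mem_diag (m : ℕ) (v w : Fin m → ℝ × ℝ) (h : v - w ∈ diag (Fin m)) :
    iota m v - iota m w ∈ diag (Idx m) := by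
  obtain ⟨a, ha⟩ := h
  have hv : ∀ i, v i = w i + a := fun i => by
    have := congrFun ha i
    simp only [LinearMap.pi_apply, LinearMap.id_apply, Pi.sub_apply] at this
    rw [this]; abel
  refine ⟨a, ?_⟩
  funext x
  rcases x with i | ⟨k, p⟩
  · simp [iota, hv]
  · simp [iota, hv, extraPoint_add]

/-- The induced map `ῑ : ℝ^{2m}/ℝ² → ℝ^{2m+2N}/ℝ²`. -/
noncomputable def iotaBar (m : ℕ) (x : (Fin m → ℝ × ℝ) ⧸ diag (Fin m)) :
    (Idx m → ℝ × ℝ) ⧸ diag (Idx m) :=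
  Quotient.liftOn' x (fun v => (diag (Idx m)).mkQ (iota m v)) fun v w h =>
    (Submodule.Quotient.eq _).2
      (iota_sub_mem_diag m v w ((Submodule.quotientRel_def _).1 h))

/-! ### The new fan and refinement -/

/-- The collection `𝒬'_{m+N}` of the cones of the quotient fan `𝒬_{m+N}` that correspond to the
equivalence classes of the vectors `ι(v)`. -/
def subfanQ (m : ℕ) : Set (Set ((Idx m → ℝ × ℝ) ⧸ diag (Idx m))) :=
  {σ ∈ quotientFan fanP (Idx m) | ∃ v : Fin m → ℝ × ℝ, σ = quotientCone fanP (iota m v)}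

/-- The fan `𝒬̃_m`: the collection of the preimages under `ῑ` of the cones of `𝒬'_{m+N}`. -/
def fanQTilde (m : ℕ) : Set (Set ((Fin m → ℝ × ℝ) ⧸ diag (Fin m))) :=
  {σ | ∃ τ ∈ subfanQ m, σ = iotaBar m ⁻¹' τ}

/-- The fan `F` refines the fan `G`: every cone of `F` is contained in a cone of `G`, and every
cone of `G` is a union of cones of `F` (in particular the supports agree). -/
def Refines {V : Type} (F G : Set (Set V)) : Prop :=
  (∀ σ ∈ F, ∃ τ ∈ G, σ ⊆ τ) ∧ ∀ τ ∈ G, τ = ⋃₀ {σ ∈ F | σ ⊆ τ}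

end SpiderFan

/-!
Write `c`, `d`, `e = c - d` for the first coordinate, the second coordinate and the difference of a
point of `ℝ²`. The maximal cones of the fan of `ℙ²` are the three sectors in which a given one of
the homogeneous coordinates `(c, d, 0)` is minimal, and every cone is the intersection of the
sectors containing it. Whether `v + ℝ²` meets a product of such cones is therefore the feasibility
of a system of inequalities between `a.1`, `a.2`, `a.1 - a.2` and constants; by Fourier–Motzkin
elimination it depends only on the order of the `c i`, of the `d i` and of the `e i`, and on the
signs of `c j - d i - e k` for triples of spiders in one particular relative position. In
`metCones_subset_iff` this becomes: `metCones fanP v ⊆ metCones fanP w` exactly when `w` satisfies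
all the weak inequalities of this kind that hold for `v` (`Specializes v w`).

Since these are closed conditions, stable under adding a multiple of `v`, the closure of the class
of `v` is `{w | metCones fanP v ⊆ metCones fanP w}` (`closure_equivClass_fanP`). The same holds for
the dual fan by negation, so the theorem reduces to the implication
`metCones_dual_subset_of_iota`: if `ι w` is a specialization of `ι v` for `fanP`, then `w` is a
specialization of `v` for `fanPDual`. The point is that negation reverses the relative position for
which the sign of `c j - d i - e k` counts. In the reversed position the attached point `x₁₃` of the
spiders `i` and `j` is `(c j, d i)`, so that this sign is just the comparison of the coordinate `e`
of two of the points of `ι v`.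
-/

namespace SpiderFan

/-! ### Cones of the fan of the projective plane -/

/-- The homogeneous coordinates `(x, y, 0)` of a point `(x, y)` of the plane. -/
def hcoord (p : ℝ × ℝ) : Fin 3 → ℝ := ![p.1, p.2, 0]

/-- The closed sector in which the `n`-th homogeneous coordinate is minimal. It is generated by the
two ray generators other than `rayGen n`. -/
def sector (n : Fin 3) : Set (ℝ × ℝ) := {p | ∀ k, hcoord p n ≤ hcoord p k}

theorem mem_sector_zero {p : ℝ × ℝ} : p ∈ sector 0 ↔ p.1 ≤ p.2 ∧ p.1 ≤ 0 := by
  simp [sector, hcoord, Fin.forall_fin_succ]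

theorem mem_sector_one {p : ℝ × ℝ} : p ∈ sector 1 ↔ p.2 ≤ p.1 ∧ p.2 ≤ 0 := by
  simp [sector, hcoord, Fin.forall_fin_succ]

theorem mem_sector_two {p : ℝ × ℝ} : p ∈ sector 2 ↔ 0 ≤ p.1 ∧ 0 ≤ p.2 := by
  simp [sector, hcoord, Fin.forall_fin_succ]

theorem exists_mem_sector (p : ℝ × ℝ) : ∃ n, p ∈ sector n :=
  Finite.exists_min (hcoord p)

theorem rayGen_mem_sector {k n : Fin 3} (h : k ≠ n) : rayGen k ∈ sector n := by
  fin_cases k <;> fin_cases n <;>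
    simp_all [rayGen, mem_sector_zero, mem_sector_one, mem_sector_two]

theorem add_mem_sector {n : Fin 3} {p q : ℝ × ℝ} (hp : p ∈ sector n) (hq : q ∈ sector n) :
    p + q ∈ sector n := by
  intro k
  have h₁ := hp k
  have h₂ := hq k
  fin_cases n <;> fin_cases k <;> simp [hcoord] at * <;> linarith

theorem smul_mem_sector {n : Fin 3} {t : ℝ} (ht : 0 ≤ t) {p : ℝ × ℝ} (hp : p ∈ sector n) :
    t • p ∈ sector n := by
  intro k
  have h := mul_le_mul_of_nonneg_left (hp k) ht
  fin_cases n <;> fin_cases k <;> simp_all [hcoord]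

theorem mem_hull_rayGen_iff {T : Set (Fin 3)} {p : ℝ × ℝ} :
    p ∈ PointedCone.hull ℝ (rayGen '' T) ↔ ∀ n ∉ T, p ∈ sector n := by
  constructor
  · intro hp n hn
    induction hp using Submodule.span_induction with
    | mem x hx =>
      obtain ⟨k, hk, rfl⟩ := hx
      exact rayGen_mem_sector fun h => hn (h ▸ hk)
    | zero => intro k; fin_cases n <;> fin_cases k <;> simp [hcoord]
    | add x y _ _ hx hy => exact add_mem_sector hx hy
    | smul t x _ hx => exact smul_mem_sector t.2 hx
  · intro h
    -- Subtracting the minimal homogeneous coordinate writes `p` as a nonnegative combination of the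
    -- generators; the coefficient of `rayGen n` vanishes when `p ∈ sector n`.
    obtain ⟨n₀, h₀⟩ := exists_mem_sector p
    have key : ∀ n, (hcoord p n - hcoord p n₀) • rayGen n ∈
        PointedCone.hull ℝ (rayGen '' T) := by
      intro n
      by_cases hn : n ∈ T
      · exact Submodule.smul_mem _
          (⟨hcoord p n - hcoord p n₀, sub_nonneg.2 (h₀ n)⟩ : {t : ℝ // 0 ≤ t})
          (Submodule.subset_span ⟨n, hn, rfl⟩)
      · rw [le_antisymm (h n hn n₀) (h₀ n), sub_self, zero_smul]
        exact zero_mem _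
    have hsum := add_mem (add_mem (key 0) (key 1)) (key 2)
    convert hsum using 1
    ext <;> simp [hcoord, rayGen]

/-! ### Cones met by a translate of the diagonal -/

theorem inter_diag_nonempty_iff {I : Type} (s : I → Set (ℝ × ℝ)) (v : I → ℝ × ℝ) :
    (Set.pi Set.univ s ∩ {x | x - v ∈ diag I}).Nonempty ↔ ∃ a, ∀ i, v i + a ∈ s i := by
  constructor
  · rintro ⟨x, hx, a, ha⟩
    refine ⟨a, fun i => ?_⟩
    have h : a = x i - v i := congrFun ha i
    rw [h, add_sub_cancel]
    exact hx i trivial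
  · rintro ⟨a, ha⟩
    exact ⟨fun i => v i + a, fun i _ => ha i, a, by ext i <;> simp⟩

theorem metCones_subset_iff_forall {F : Set (Set (ℝ × ℝ))} {I : Type} {v w : I → ℝ × ℝ} :
    metCones F v ⊆ metCones F w ↔ ∀ s : I → Set (ℝ × ℝ), (∀ i, s i ∈ F) →
      (∃ a, ∀ i, v i + a ∈ s i) → ∃ a, ∀ i, w i + a ∈ s i := by
  constructor
  · intro h s hs hv
    exact (inter_diag_nonempty_iff s w).1
      (h ⟨⟨s, hs, rfl⟩, (inter_diag_nonempty_iff s v).2 hv⟩).2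
  · rintro h _ ⟨⟨s, hs, rfl⟩, hv⟩
    exact ⟨⟨s, hs, rfl⟩,
      (inter_diag_nonempty_iff s w).2 (h s hs ((inter_diag_nonempty_iff s v).1 hv))⟩

theorem metCones_congr (F : Set (Set (ℝ × ℝ))) {I : Type} {v w : I → ℝ × ℝ}
    (h : v - w ∈ diag I) : metCones F v = metCones F w := by
  have : {x | x - v ∈ diag I} = {x | x - w ∈ diag I} := by
    ext x
    have e : x - w = (x - v) + (v - w) := by abel
    rw [Set.mem_ofPred_eq, Set.mem_ofPred_eq, e, Submodule.add_mem_iff_left _ h]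
  simp only [metCones, this]

/-- Passing to the dual fan amounts to negating the vectors. -/
theorem metCones_dual_subset_iff {I : Type} {v w : I → ℝ × ℝ} :
    metCones fanPDual v ⊆ metCones fanPDual w ↔ metCones fanP (-v) ⊆ metCones fanP (-w) := by
  have aux : ∀ (u : I → ℝ × ℝ) (s : I → Set (ℝ × ℝ)),
      (∃ a, ∀ i, u i + a ∈ (fun x => -x) '' s i) ↔ ∃ a, ∀ i, (-u) i + a ∈ s i := by
    intro u s
    have hneg : ∀ i (x : ℝ × ℝ), x ∈ (fun x => -x) '' s i ↔ -x ∈ s i := by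
      intro i x
      rw [Set.image_neg_eq_neg, Set.mem_neg]
    simp only [hneg, neg_add, Pi.neg_apply]
    exact ⟨fun ⟨a, ha⟩ => ⟨-a, ha⟩, fun ⟨a, ha⟩ => ⟨-a, by simpa using ha⟩⟩
  simp only [metCones_subset_iff_forall]
  constructor
  · intro h s hs hv
    rw [← aux] at hv ⊢
    exact h (fun i => (fun x => -x) '' s i) (fun i => ⟨s i, hs i, rfl⟩) hv
  · intro h s hs hv
    choose τ hτ hsτ using hs
    obtain rfl : s = fun i => (fun x => -x) '' τ i := funext hsτ
    exact (aux w τ).2 (h τ hτ ((aux v τ).1 hv))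

/-- Every position `a` of the translate of `v` has a counterpart for `w` that lies in all the
sectors in which the translate of `v` lies. -/
theorem metCones_fanP_subset_iff {I : Type} {v w : I → ℝ × ℝ} :
    metCones fanP v ⊆ metCones fanP w ↔
      ∀ a, ∃ a', ∀ i n, v i + a ∈ sector n → w i + a' ∈ sector n := by
  rw [metCones_subset_iff_forall]
  constructor
  · intro h a
    -- the smallest cone of the fan containing `v i + a`
    obtain ⟨a', ha'⟩ := h
      (fun i => (PointedCone.hull ℝ (rayGen '' {n | v i + a ∉ sector n}) : Set (ℝ × ℝ)))
      (fun i => ⟨_, fun hT => by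
        obtain ⟨n, hn⟩ := exists_mem_sector (v i + a)
        exact (Set.eq_univ_iff_forall.1 hT n) hn, rfl⟩)
      ⟨a, fun i => mem_hull_rayGen_iff.2 fun n hn => not_not.1 hn⟩
    exact ⟨a', fun i n hn => mem_hull_rayGen_iff.1 (ha' i) n (not_not.2 hn)⟩
  · rintro h s hs ⟨a, ha⟩
    obtain ⟨a', ha'⟩ := h a
    refine ⟨a', fun i => ?_⟩
    obtain ⟨T, -, hT⟩ := hs i
    have hi := ha i
    rw [hT] at hi ⊢
    exact mem_hull_rayGen_iff.2 fun n hn => ha' i n (mem_hull_rayGen_iff.1 hi n hn)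

/-! ### Description by linear inequalities -/

/-- The relative position of the spiders with centres `-v i`, `-v j`, `-v k` in which the horizontal
ray of the `i`-th, the vertical ray of the `j`-th and the diagonal ray of the `k`-th meet pairwise.
The sign of `(v j).1 - (v i).2 - ((v k).1 - (v k).2)` then tells on which side of the third ray the
common point of the first two lies. -/
structure Interlaced {I : Type} (v : I → ℝ × ℝ) (i j k : I) : Prop where
  fst_ji : (v j).1 ≤ (v i).1
  fst_kj : (v k).1 ≤ (v j).1
  snd_ij : (v i).2 ≤ (v j).2
  snd_ki : (v k).2 ≤ (v i).2
  sub_ki : (v k).1 - (v k).2 ≤ (v i).1 - (v i).2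
  sub_jk : (v j).1 - (v j).2 ≤ (v k).1 - (v k).2

/-- `w` satisfies every weak inequality, among those that matter for the quotient fan, which holds
for `v`. -/
structure Specializes {I : Type} (v w : I → ℝ × ℝ) : Prop where
  fst : ∀ i j, (v i).1 ≤ (v j).1 → (w i).1 ≤ (w j).1
  snd : ∀ i j, (v i).2 ≤ (v j).2 → (w i).2 ≤ (w j).2
  sub : ∀ i j, (v i).1 - (v i).2 ≤ (v j).1 - (v j).2 → (w i).1 - (w i).2 ≤ (w j).1 - (w j).2
  le : ∀ i j k, Interlaced v i j k → (v j).1 - (v i).2 ≤ (v k).1 - (v k).2 →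
    (w j).1 - (w i).2 ≤ (w k).1 - (w k).2
  ge : ∀ i j k, Interlaced v i j k → (v k).1 - (v k).2 ≤ (v j).1 - (v i).2 →
    (w k).1 - (w k).2 ≤ (w j).1 - (w i).2

theorem Specializes.refl {I : Type} (v : I → ℝ × ℝ) : Specializes v v :=
  ⟨fun _ _ h => h, fun _ _ h => h, fun _ _ h => h, fun _ _ _ _ h => h, fun _ _ _ _ h => h⟩

theorem exists_forall_le_forall_ge {L U : Set ℝ} (hL : L.Finite) (hU : U.Finite)
    (h : ∀ l ∈ L, ∀ u ∈ U, l ≤ u) : ∃ x, (∀ l ∈ L, l ≤ x) ∧ ∀ u ∈ U, x ≤ u := by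
  rcases U.eq_empty_or_nonempty with rfl | hne
  · obtain ⟨x, hx⟩ := hL.bddAbove
    exact ⟨x, fun l hl => hx hl, by simp⟩
  · exact ⟨sInf U, fun l hl => le_csInf hne fun u hu => h l hl u hu,
      fun u hu => csInf_le hU.bddBelow hu⟩

/-- Feasibility criterion for translates of sectors: the conditions are those obtained by
eliminating first `a.1`, then `a.2`. -/
theorem exists_forall_mem_sector {I : Type} [Finite I] (w : I → ℝ × ℝ) (α β γ : Set I)
    (h₁ : ∀ i ∈ α, ∀ j ∈ β, (w j).1 ≤ (w i).1) (h₂ : ∀ i ∈ α, ∀ k ∈ γ, (w k).2 ≤ (w i).2)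
    (h₃ : ∀ j ∈ β, ∀ k ∈ γ, (w j).1 - (w j).2 ≤ (w k).1 - (w k).2)
    (h₄ : ∀ i ∈ α, ∀ j ∈ β, ∀ k ∈ γ, (w j).1 - (w i).2 ≤ (w k).1 - (w k).2)
    (h₅ : ∀ i ∈ α, ∀ j ∈ β, ∀ k ∈ γ, (w j).1 - (w j).2 ≤ (w i).1 - (w k).2) :
    ∃ a, (∀ i ∈ α, w i + a ∈ sector 2) ∧ (∀ j ∈ β, w j + a ∈ sector 0) ∧
      ∀ k ∈ γ, w k + a ∈ sector 1 := by
  obtain ⟨y, hyl, hyu⟩ := exists_forall_le_forall_ge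
    (L := (fun i => -(w i).2) '' α ∪
      Set.image2 (fun i j => (w j).1 - (w j).2 - (w i).1) α β)
    (U := (fun k => -(w k).2) '' γ ∪
      Set.image2 (fun j k => (w k).1 - (w k).2 - (w j).1) β γ)
    ((α.toFinite.image _).union (α.toFinite.image2 _ β.toFinite))
    ((γ.toFinite.image _).union (β.toFinite.image2 _ γ.toFinite)) (by
      rintro _ (⟨i, hi, rfl⟩ | ⟨i, hi, j, hj, rfl⟩) _ (⟨k, hk, rfl⟩ | ⟨j', hj', k, hk, rfl⟩)
      · simpa using h₂ i hi k hk
      · linarith [h₄ i hi j' hj' k hk]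
      · linarith [h₅ i hi j hj k hk]
      · linarith [h₁ i hi j' hj', h₃ j hj k hk])
  obtain ⟨x, hxl, hxu⟩ := exists_forall_le_forall_ge
    (L := (fun i => -(w i).1) '' α ∪ (fun k => y - ((w k).1 - (w k).2)) '' γ)
    (U := (fun j => -(w j).1) '' β ∪ (fun j => y - ((w j).1 - (w j).2)) '' β)
    ((α.toFinite.image _).union (γ.toFinite.image _))
    ((β.toFinite.image _).union (β.toFinite.image _)) (by
      rintro _ (⟨i, hi, rfl⟩ | ⟨k, hk, rfl⟩) _ (⟨j, hj, rfl⟩ | ⟨j, hj, rfl⟩)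
      · simpa using h₁ i hi j hj
      · linarith [hyl _ (Or.inr ⟨i, hi, j, hj, rfl⟩)]
      · linarith [hyu _ (Or.inr ⟨j, hj, k, hk, rfl⟩)]
      · linarith [h₃ j hj k hk])
  refine ⟨(x, y), fun i hi => mem_sector_two.2 ?_, fun j hj => mem_sector_zero.2 ?_,
    fun k hk => mem_sector_one.2 ?_⟩ <;> simp only [Prod.fst_add, Prod.snd_add]
  · have := hyl _ (Or.inl ⟨i, hi, rfl⟩)
    have := hxl _ (Or.inl ⟨i, hi, rfl⟩)
    constructor <;> linarith
  · have := hxu _ (Or.inl ⟨j, hj, rfl⟩)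
    have := hxu _ (Or.inr ⟨j, hj, rfl⟩)
    constructor <;> linarith
  · have := hyu _ (Or.inl ⟨k, hk, rfl⟩)
    have := hxl _ (Or.inr ⟨k, hk, rfl⟩)
    constructor <;> linarith

theorem Specializes.metCones_subset {I : Type} [Finite I] {v w : I → ℝ × ℝ}
    (h : Specializes v w) : metCones fanP v ⊆ metCones fanP w := by
  rw [metCones_fanP_subset_iff]
  intro a
  have hα : ∀ i ∈ {i | v i + a ∈ sector 2}, 0 ≤ (v i).1 + a.1 ∧ 0 ≤ (v i).2 + a.2 :=
    fun i hi => mem_sector_two.1 hi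
  have hβ : ∀ i ∈ {i | v i + a ∈ sector 0}, (v i).1 + a.1 ≤ (v i).2 + a.2 ∧ (v i).1 + a.1 ≤ 0 :=
    fun i hi => mem_sector_zero.1 hi
  have hγ : ∀ i ∈ {i | v i + a ∈ sector 1}, (v i).2 + a.2 ≤ (v i).1 + a.1 ∧ (v i).2 + a.2 ≤ 0 :=
    fun i hi => mem_sector_one.1 hi
  obtain ⟨a', h₂, h₀, h₁⟩ := exists_forall_mem_sector w {i | v i + a ∈ sector 2}
    {i | v i + a ∈ sector 0} {i | v i + a ∈ sector 1}
    (fun i hi j hj => h.fst _ _ (by linarith [hα i hi, hβ j hj]))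
    (fun i hi k hk => h.snd _ _ (by linarith [hα i hi, hγ k hk]))
    (fun j hj k hk => h.sub _ _ (by linarith [hβ j hj, hγ k hk]))
    (by
      -- Unless the spiders are interlaced, the inequality follows from those for pairs.
      intro i hi j hj k hk
      obtain ⟨i₁, i₂⟩ := hα i hi
      obtain ⟨j₁, j₂⟩ := hβ j hj
      obtain ⟨k₁, k₂⟩ := hγ k hk
      by_contra! hlt
      have c := h.fst j i (by linarith)
      have d := h.snd k i (by linarith)
      have e := h.sub j k (by linarith)
      have c' := mt (h.fst j k) (by linarith)
      have d' := mt (h.snd j i) (by linarith)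
      have e' := mt (h.sub i k) (by linarith)
      refine hlt.not_ge (h.le i j k ⟨?_, ?_, ?_, ?_, ?_, ?_⟩ ?_) <;> linarith)
    (by
      -- Here the same holds with the cyclically permuted triple `k, i, j`.
      intro i hi j hj k hk
      obtain ⟨i₁, i₂⟩ := hα i hi
      obtain ⟨j₁, j₂⟩ := hβ j hj
      obtain ⟨k₁, k₂⟩ := hγ k hk
      by_contra! hlt
      have c := h.fst j i (by linarith)
      have d := h.snd k i (by linarith)
      have e := h.sub j k (by linarith)
      have c' := mt (h.fst k i) (by linarith)
      have d' := mt (h.snd k j) (by linarith)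
      have e' := mt (h.sub j i) (by linarith)
      refine hlt.not_ge (h.ge k i j ⟨?_, ?_, ?_, ?_, ?_, ?_⟩ ?_) <;> linarith)
  refine ⟨a', fun i n hn => ?_⟩
  fin_cases n
  exacts [h₀ i hn, h₁ i hn, h₂ i hn]

theorem Specializes.of_metCones_subset {I : Type} {v w : I → ℝ × ℝ}
    (h : metCones fanP v ⊆ metCones fanP w) : Specializes v w := by
  rw [metCones_fanP_subset_iff] at h
  simp only [Fin.forall_fin_succ, Fin.succ_zero_eq_one,
    Fin.succ_one_eq_two, mem_sector_zero, mem_sector_one, mem_sector_two, Prod.fst_add,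
    Prod.snd_add, IsEmpty.forall_iff, and_true] at h
  -- For pairs, `a` puts `v j + a` on the ray between two sectors, far enough out that `v i + a` lies
  -- in one of them. For triples, `a` is the common point of the horizontal and the vertical ray.
  constructor
  · intro i j hij
    obtain ⟨a', ha⟩ := h (-(v j).1, max (-(v j).2) (-(v i).2))
    have m₁ := le_max_left (-(v j).2) (-(v i).2)
    have m₂ := le_max_right (-(v j).2) (-(v i).2)
    have hi := (ha i).1 ⟨by simp only; linarith, by simp only; linarith⟩
    have hj := (ha j).2.2 ⟨by simp only; linarith, by simp only; linarith⟩
    linarith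
  · intro i j hij
    obtain ⟨a', ha⟩ := h (max (-(v j).1) (-(v i).1), -(v j).2)
    have m₁ := le_max_left (-(v j).1) (-(v i).1)
    have m₂ := le_max_right (-(v j).1) (-(v i).1)
    have hi := (ha i).2.1 ⟨by simp only; linarith, by simp only; linarith⟩
    have hj := (ha j).2.2 ⟨by simp only; linarith, by simp only; linarith⟩
    linarith
  · intro i j hij
    obtain ⟨a', ha⟩ := h (min (-(v j).1) (-(v i).1),
      min (-(v j).1) (-(v i).1) + ((v j).1 - (v j).2))
    have m₁ := min_le_left (-(v j).1) (-(v i).1)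
    have m₂ := min_le_right (-(v j).1) (-(v i).1)
    have hi := (ha i).1 ⟨by simp only; linarith, by simp only; linarith⟩
    have hj := (ha j).2.1 ⟨by simp only; linarith, by simp only; linarith⟩
    linarith
  all_goals
    rintro i j k ⟨h₁, h₂, h₃, h₄, h₅, h₆⟩ hT
    obtain ⟨a', ha⟩ := h (-(v j).1, -(v i).2)
    have i₁ := (ha i).2.1 ⟨by simp only; linarith, by simp only; linarith⟩
    have i₂ := (ha i).2.2 ⟨by simp only; linarith, by simp only; linarith⟩
    have j₁ := (ha j).1 ⟨by simp only; linarith, by simp only; linarith⟩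
    have j₂ := (ha j).2.2 ⟨by simp only; linarith, by simp only; linarith⟩
  · have hk := (ha k).2.1 ⟨by simp only; linarith, by simp only; linarith⟩
    linarith
  · have hk := (ha k).1 ⟨by simp only; linarith, by simp only; linarith⟩
    linarith

theorem metCones_subset_iff {I : Type} [Finite I] {v w : I → ℝ × ℝ} :
    metCones fanP v ⊆ metCones fanP w ↔ Specializes v w :=
  ⟨Specializes.of_metCones_subset, Specializes.metCones_subset⟩

/-! ### Closures of equivalence classes -/

theorem Specializes.add_smul {I : Type} {v w : I → ℝ × ℝ} (h : Specializes v w) {t : ℝ}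
    (ht : 0 ≤ t) : Specializes v (w + t • v) := by
  constructor
  · intro i j hv
    simpa using add_le_add (h.fst i j hv) (mul_le_mul_of_nonneg_left hv ht)
  · intro i j hv
    simpa using add_le_add (h.snd i j hv) (mul_le_mul_of_nonneg_left hv ht)
  · intro i j hv
    have := add_le_add (h.sub i j hv) (mul_le_mul_of_nonneg_left hv ht)
    simp only [Pi.add_apply, Pi.smul_apply, Prod.fst_add, Prod.snd_add, Prod.smul_fst,
      Prod.smul_snd, smul_eq_mul]
    linarith
  · intro i j k hv hT
    have := add_le_add (h.le i j k hv hT) (mul_le_mul_of_nonneg_left hT ht)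
    simp only [Pi.add_apply, Pi.smul_apply, Prod.fst_add, Prod.snd_add, Prod.smul_fst,
      Prod.smul_snd, smul_eq_mul]
    linarith
  · intro i j k hv hT
    have := add_le_add (h.ge i j k hv hT) (mul_le_mul_of_nonneg_left hT ht)
    simp only [Pi.add_apply, Pi.smul_apply, Prod.fst_add, Prod.snd_add, Prod.smul_fst,
      Prod.smul_snd, smul_eq_mul]
    linarith

/-- A weak inequality between values at `w + t • v` holds for `v` as well: otherwise the opposite
inequality would be strict for `v`, weak for `w`, and hence strict for `w + t • v`. -/
theorem Specializes.add_smul_specializes {I : Type} {v w : I → ℝ × ℝ} (h : Specializes v w)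
    {t : ℝ} (ht : 0 < t) : Specializes (w + t • v) v := by
  have key : ∀ x y x' y' : ℝ, (y ≤ x → y' ≤ x') → x' + t * x ≤ y' + t * y → x ≤ y := by
    intro x y x' y' hxy hle
    by_contra! hlt
    have := hxy hlt.le
    have := mul_lt_mul_of_pos_left hlt ht
    linarith
  have h₁ : ∀ i j, ((w + t • v) i).1 ≤ ((w + t • v) j).1 → (v i).1 ≤ (v j).1 :=
    fun i j hij => key _ _ _ _ (h.fst j i) (by simpa using hij)
  have h₂ : ∀ i j, ((w + t • v) i).2 ≤ ((w + t • v) j).2 → (v i).2 ≤ (v j).2 :=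
    fun i j hij => key _ _ _ _ (h.snd j i) (by simpa using hij)
  have h₃ : ∀ i j, ((w + t • v) i).1 - ((w + t • v) i).2 ≤ ((w + t • v) j).1 - ((w + t • v) j).2 →
      (v i).1 - (v i).2 ≤ (v j).1 - (v j).2 := by
    refine fun i j hij => key _ _ _ _ (h.sub j i) ?_
    simp only [Pi.add_apply, Pi.smul_apply, Prod.fst_add, Prod.snd_add, Prod.smul_fst,
      Prod.smul_snd, smul_eq_mul] at hij
    linarith
  have h₄ : ∀ i j k, Interlaced (w + t • v) i j k → Interlaced v i j k := fun i j k hi =>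
    ⟨h₁ _ _ hi.fst_ji, h₁ _ _ hi.fst_kj, h₂ _ _ hi.snd_ij, h₂ _ _ hi.snd_ki, h₃ _ _ hi.sub_ki,
      h₃ _ _ hi.sub_jk⟩
  refine ⟨h₁, h₂, h₃, fun i j k hi hT => key _ _ _ _ (h.ge i j k (h₄ i j k hi)) ?_,
    fun i j k hi hT => key _ _ _ _ (h.le i j k (h₄ i j k hi)) ?_⟩ <;>
  · simp only [Pi.add_apply, Pi.smul_apply, Prod.fst_add, Prod.snd_add, Prod.smul_fst,
      Prod.smul_snd, smul_eq_mul] at hT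
    linarith

theorem isClosed_setOf_specializes {I : Type} (v : I → ℝ × ℝ) :
    IsClosed {w | Specializes v w} := by
  have : {w | Specializes v w} =
      {w | (∀ i j, (v i).1 ≤ (v j).1 → (w i).1 ≤ (w j).1) ∧
        (∀ i j, (v i).2 ≤ (v j).2 → (w i).2 ≤ (w j).2) ∧
        (∀ i j, (v i).1 - (v i).2 ≤ (v j).1 - (v j).2 →
          (w i).1 - (w i).2 ≤ (w j).1 - (w j).2) ∧
        (∀ i j k, Interlaced v i j k → (v j).1 - (v i).2 ≤ (v k).1 - (v k).2 →
          (w j).1 - (w i).2 ≤ (w k).1 - (w k).2) ∧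
        (∀ i j k, Interlaced v i j k → (v k).1 - (v k).2 ≤ (v j).1 - (v i).2 →
          (w k).1 - (w k).2 ≤ (w j).1 - (w i).2)} := by
    ext w
    exact ⟨fun h => ⟨h.1, h.2, h.3, h.4, h.5⟩, fun ⟨h₁, h₂, h₃, h₄, h₅⟩ => ⟨h₁, h₂, h₃, h₄, h₅⟩⟩
  rw [this]
  simp only [Set.ofPred_and, Set.ofPred_forall]
  refine IsClosed.inter ?_ (IsClosed.inter ?_ (IsClosed.inter ?_ (IsClosed.inter ?_ ?_)))
  all_goals
    repeat' refine isClosed_iInter fun _ => ?_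
    exact isClosed_le (by fun_prop) (by fun_prop)

theorem closure_equivClass_fanP {I : Type} [Finite I] (v : I → ℝ × ℝ) :
    closure (equivClass fanP v) = {w | metCones fanP v ⊆ metCones fanP w} := by
  apply Set.Subset.antisymm
  · simp only [metCones_subset_iff]
    refine closure_minimal (fun w hw => ?_) (isClosed_setOf_specializes v)
    exact metCones_subset_iff.1 hw.ge
  · intro w hw
    have hw := metCones_subset_iff.1 hw
    have hlim : Filter.Tendsto (fun t : ℝ => w + t • v) (nhdsWithin 0 (Set.Ioi 0)) (nhds w) := by
      have : Continuous fun t : ℝ => w + t • v := by fun_prop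
      simpa using (this.tendsto 0).mono_left nhdsWithin_le_nhds
    refine mem_closure_of_tendsto hlim ?_
    filter_upwards [self_mem_nhdsWithin] with t ht
    exact Set.Subset.antisymm (metCones_subset_iff.2 (hw.add_smul_specializes ht))
      (metCones_subset_iff.2 (hw.add_smul (le_of_lt ht)))

theorem closure_equivClass_fanPDual {I : Type} [Finite I] (v : I → ℝ × ℝ) :
    closure (equivClass fanPDual v) = {w | metCones fanPDual v ⊆ metCones fanPDual w} := by
  have h : equivClass fanPDual v = Homeomorph.neg (I → ℝ × ℝ) ⁻¹' equivClass fanP (-v) := by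
    ext w
    change metCones fanPDual w = metCones fanPDual v ↔ metCones fanP (-w) = metCones fanP (-v)
    simp only [Set.Subset.antisymm_iff, metCones_dual_subset_iff]
  rw [h, ← Homeomorph.preimage_closure, closure_equivClass_fanP]
  ext w
  exact metCones_dual_subset_iff.symm

/-! ### The points attached to pairs of spiders -/

/-- On this closed region of positions the attached point is given by a single formula, also where
the spiders are not in general position. -/
theorem extraPoint_e13_of_le {v w : ℝ × ℝ} (h₁ : v.1 ≤ w.1) (h₂ : w.2 ≤ v.2) :
    extraPoint v w .e13 = (w.1, v.2) := by
  have hr : v.1 < w.1 → w.2 < v.2 → redPoint v w = (w.1, v.2) := by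
    intro h₃ h₄
    unfold redPoint
    grind
  unfold extraPoint
  ext <;> grind [triple]

theorem extraPoint_e13_of_ge {v w : ℝ × ℝ} (h₁ : w.1 ≤ v.1) (h₂ : v.2 ≤ w.2) :
    extraPoint v w .e13 = (v.1, w.2) := by
  have hr : w.1 < v.1 → v.2 < w.2 → redPoint v w = (v.1, w.2) := by
    intro h₃ h₄
    unfold redPoint
    grind
  unfold extraPoint
  ext <;> grind [triple]

/-- Some component of `ι`, chosen independently of `v`, is equal to `((v j).1, (v i).2)` at all `v`
with `(v i).1 ≤ (v j).1` and `(v j).2 ≤ (v i).2`. -/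
theorem exists_iota_eq {m : ℕ} (i j : Fin m) : ∃ x : Idx m, ∀ v : Fin m → ℝ × ℝ,
    (v i).1 ≤ (v j).1 → (v j).2 ≤ (v i).2 → iota m v x = ((v j).1, (v i).2) := by
  rcases lt_trichotomy i j with h | rfl | h
  · exact ⟨.inr (.e13, ⟨(i, j), h⟩), fun v h₁ h₂ => extraPoint_e13_of_le h₁ h₂⟩
  · exact ⟨.inl i, fun v _ _ => rfl⟩
  · exact ⟨.inr (.e13, ⟨(j, i), h⟩), fun v h₁ h₂ => extraPoint_e13_of_ge h₁ h₂⟩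

theorem Specializes.neg_of_iota {m : ℕ} {v w : Fin m → ℝ × ℝ}
    (h : Specializes (iota m v) (iota m w)) : Specializes (-v) (-w) := by
  have h₁ : ∀ i j, (v i).1 ≤ (v j).1 → (w i).1 ≤ (w j).1 := fun i j => h.fst (.inl i) (.inl j)
  have h₂ : ∀ i j, (v i).2 ≤ (v j).2 → (w i).2 ≤ (w j).2 := fun i j => h.snd (.inl i) (.inl j)
  have h₃ : ∀ i j, (v i).1 - (v i).2 ≤ (v j).1 - (v j).2 →
      (w i).1 - (w i).2 ≤ (w j).1 - (w j).2 := fun i j => h.sub (.inl i) (.inl j)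
  constructor
  · intro i j hij
    simpa using h₁ j i (by simpa using hij)
  · intro i j hij
    simpa using h₂ j i (by simpa using hij)
  · intro i j hij
    simp only [Pi.neg_apply, Prod.fst_neg, Prod.snd_neg] at hij ⊢
    linarith [h₃ j i (by linarith)]
  all_goals
    intro i j k hi hT
    have c := hi.fst_ji
    have d := hi.snd_ij
    simp only [Pi.neg_apply, Prod.fst_neg, Prod.snd_neg, neg_le_neg_iff] at c d hT ⊢
    obtain ⟨x, hx⟩ := exists_iota_eq i j
    have hv := hx v c d
    have hw := hx w (h₁ _ _ c) (h₂ _ _ d)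
  · have := h.sub (.inl k) x
    rw [hv, hw] at this
    simp only [iota] at this
    linarith [this (by linarith)]
  · have := h.sub x (.inl k)
    rw [hv, hw] at this
    simp only [iota] at this
    linarith [this (by linarith)]

instance : Finite HeavyPair :=
  Finite.of_injective (fun | .e12 => (0 : Fin 3) | .e13 => 1 | .e23 => 2) fun a b => by
    cases a <;> cases b <;> simp

theorem metCones_dual_subset_of_iota {m : ℕ} {v w : Fin m → ℝ × ℝ}
    (h : metCones fanP (iota m v) ⊆ metCones fanP (iota m w)) :
    metCones fanPDual v ⊆ metCones fanPDual w :=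
  metCones_dual_subset_iff.2 (Specializes.of_metCones_subset h).neg_of_iota.metCones_subset

/-! ### Refinement -/

theorem preimage_iotaBar_subset {m : ℕ} (v : Fin m → ℝ × ℝ) :
    iotaBar m ⁻¹' quotientCone fanP (iota m v) ⊆ quotientCone fanPDual v := by
  intro x hx
  obtain ⟨w, rfl⟩ := (diag (Fin m)).mkQ_surjective x
  obtain ⟨z, hz, hzw⟩ := hx
  refine ⟨w, ?_, rfl⟩
  rw [closure_equivClass_fanP] at hz
  rw [closure_equivClass_fanPDual]
  have hd : z - iota m w ∈ diag (Idx m) := (Submodule.Quotient.eq _).1 hzw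
  exact metCones_dual_subset_of_iota (hz.trans (metCones_congr fanP hd).le)

theorem preimage_iotaBar_mem_fanQTilde {m : ℕ} (v : Fin m → ℝ × ℝ) :
    iotaBar m ⁻¹' quotientCone fanP (iota m v) ∈ fanQTilde m :=
  ⟨_, ⟨⟨_, rfl⟩, v, rfl⟩, rfl⟩

end SpiderFan

open SpiderFan in
theorem mainTheorem9 (m : ℕ) :
    SpiderFan.Refines (SpiderFan.fanQTilde m) (SpiderFan.fanQDual m) := by
  constructor
  · rintro _ ⟨_, ⟨-, v, rfl⟩, rfl⟩
    exact ⟨_, ⟨v, rfl⟩, preimage_iotaBar_subset v⟩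
  · rintro _ ⟨u, rfl⟩
    apply Set.Subset.antisymm
    · rintro _ ⟨v, hv, rfl⟩
      refine ⟨_, ⟨preimage_iotaBar_mem_fanQTilde v, ?_⟩, iota m v, subset_closure rfl, rfl⟩
      refine (preimage_iotaBar_subset v).trans (Set.image_mono ?_)
      rw [closure_equivClass_fanPDual] at hv ⊢
      rw [closure_equivClass_fanPDual]
      exact fun w hw => Set.Subset.trans hv hw
    · exact Set.sUnion_subset fun σ hσ => hσ.2
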